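/- For a finite simple graph $G$ of order $n$, let $P(G,x)$ be its chromatic polynomial, i.e. the polynomial in the real variable $x$ such that $P(G,k)$ is the number of proper $k$-colorings of $G$ for every positive integer $k$. Put $$\epsilon(G,x)=\frac{P'(G,x)}{P(G,x)},\qquad \epsilon(G)=\frac{\sum_{i=1}^n (n-i)a_i}{\sum_{i=1}^n a_i},\quad\text{where } P(G,x)=\sum_{i=1}^n(-1)^{n-i}a_i x^i .$$ Let $K_n$ be the complete graph of order $n$. Then for every finite simple graph $G$ of order $n$ that is not complete, $$\epsilon(G,x)<\epsilon(K_n,x)\quad\text{for all real } x<0,$$ and in particular (from the case $x=-1$) $\epsilon(G)<\epsilon(K_n)$. -/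

import Mathlib

open Polynomial

namespace ChromaticPoly

/-- For every finite graph there is a polynomial that counts the proper `k`-colorings. -/
theorem exists_polynomial {V : Type*} [Finite V] (G : SimpleGraph V) :
    ∃ p : ℝ[X], ∀ k : ℕ, 0 < k → p.eval (k : ℝ) = Nat.card (G.Coloring (Fin k)) := by
  classical
  have := Fintype.ofFinite V
  -- inclusion-exclusion over the sets of edges that are monochromatic
  let c : Finset (Sym2 V) → ℕ := fun S =>
    Nat.card (SimpleGraph.fromEdgeSet (S : Set (Sym2 V))).ConnectedComponent
  refine ⟨∑ S ∈ G.edgeFinset.powerset, (-1) ^ S.card * X ^ c S, fun k _ => ?_⟩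
  let mono : (V → Fin k) → Sym2 V → Prop := fun f e => ∀ u ∈ e, ∀ v ∈ e, f u = f v
  have hprop : Nat.card (G.Coloring (Fin k)) =
      Nat.card {f : V → Fin k // ∀ e ∈ G.edgeFinset, ¬ mono f e} := by
    refine Nat.card_congr
      { toFun := fun C => ⟨C, ?_⟩
        invFun := fun f => SimpleGraph.Coloring.mk f.1 ?_
        left_inv := fun C => by ext; rfl
        right_inv := fun f => rfl }
    · intro e
      induction e with | _ u v =>
      intro he hm
      rw [SimpleGraph.mem_edgeFinset, SimpleGraph.mem_edgeSet] at he
      exact C.valid he (hm u (by simp) v (by simp))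
    · intro u v huv h
      refine f.2 s(u, v) (by simpa using huv) ?_
      intro a ha b hb
      rw [Sym2.mem_iff] at ha hb
      rcases ha with rfl | rfl <;> rcases hb with rfl | rfl <;> simp [h]
  have hmono : ∀ S ∈ G.edgeFinset.powerset,
      Nat.card {f : V → Fin k // ∀ e ∈ S, mono f e} = k ^ c S := by
    intro S _
    have h1 : Nat.card ((SimpleGraph.fromEdgeSet (S : Set (Sym2 V))).ConnectedComponent → Fin k)
        = k ^ c S := by
      rw [Nat.card_fun]; simp [c]
    rw [← h1]
    refine Nat.card_congr
      { toFun := fun f => SimpleGraph.ConnectedComponent.lift f.1 ?_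
        invFun := fun g => ⟨fun v => g (SimpleGraph.connectedComponentMk _ v), ?_⟩
        left_inv := fun f => rfl
        right_inv := fun g => ?_ }
    · intro u v p _
      induction p with
      | nil => rfl
      | cons h _ ih =>
        rename_i hp
        rw [SimpleGraph.fromEdgeSet_adj] at h
        exact (f.2 _ h.1 _ (by simp) _ (by simp)).trans (ih (by simp_all))
    · intro e
      induction e with | _ a b =>
      intro he u hu v hv
      by_cases huv : u = v
      · rw [huv]
      have : s(a, b) = s(u, v) := (Sym2.mem_and_mem_iff huv).1 ⟨hu, hv⟩
      rw [this] at he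
      have hadj : (SimpleGraph.fromEdgeSet (S : Set (Sym2 V))).Adj u v := by
        rw [SimpleGraph.fromEdgeSet_adj]; exact ⟨he, huv⟩
      exact congrArg g (SimpleGraph.ConnectedComponent.sound hadj.reachable)
    · funext q
      induction q using SimpleGraph.ConnectedComponent.ind
      rfl
  rw [hprop, Nat.card_eq_fintype_card, Fintype.card_subtype, Finset.card_filter]
  push_cast
  have hind : ∀ f : V → Fin k, (if ∀ e ∈ G.edgeFinset, ¬ mono f e then (1 : ℝ) else 0) =
      ∑ S ∈ G.edgeFinset.powerset, (-1) ^ S.card * (if ∀ e ∈ S, mono f e then (1 : ℝ) else 0) := by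
    intro f
    have h1 : (if ∀ e ∈ G.edgeFinset, ¬ mono f e then (1 : ℝ) else 0) =
        ∏ e ∈ G.edgeFinset, (1 - if mono f e then (1 : ℝ) else 0) := by
      have h2 := Finset.prod_boole (M₀ := ℝ) (s := G.edgeFinset) (p := fun e => ¬ mono f e)
      refine Eq.trans (by congr) (h2.symm.trans ?_)
      refine Finset.prod_congr rfl fun e _ => ?_
      by_cases h : mono f e <;> simp [h]
    rw [h1]
    simp only [sub_eq_add_neg]
    rw [Finset.prod_one_add]
    refine Finset.sum_congr rfl fun S _ => ?_
    rw [Finset.prod_neg, Finset.prod_boole]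
    congr
  simp only [hind]
  rw [Finset.sum_comm, eval_finsetSum]
  refine Finset.sum_congr rfl fun S hS => ?_
  rw [← Finset.mul_sum, ← Nat.cast_one, ← Nat.cast_zero]
  have := hmono S hS
  rw [Nat.card_eq_fintype_card, Fintype.card_subtype, Finset.card_filter] at this
  have h2 := congrArg (Nat.cast : ℕ → ℝ) this
  push_cast at h2 ⊢
  rw [h2]
  simp

end ChromaticPoly

/-- The chromatic polynomial `P(G, x)` of a finite simple graph: the polynomial whose value at
every positive integer `k` is the number of proper `k`-colorings of `G`. -/
noncomputable def chromaticPoly {V : Type*} [Finite V] (G : SimpleGraph V) : ℝ[X] :=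
  (ChromaticPoly.exists_polynomial G).choose

theorem chromaticPoly_eval {V : Type*} [Finite V] (G : SimpleGraph V) (k : ℕ) (hk : 0 < k) :
    (chromaticPoly G).eval (k : ℝ) = Nat.card (G.Coloring (Fin k)) :=
  (ChromaticPoly.exists_polynomial G).choose_spec k hk

/-- The chromatic polynomial is determined by its values at the positive integers. -/
theorem chromaticPoly_unique {V : Type*} [Finite V] (G : SimpleGraph V) (p : ℝ[X])
    (hp : ∀ k : ℕ, 0 < k → p.eval (k : ℝ) = Nat.card (G.Coloring (Fin k))) :
    p = chromaticPoly G := by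
  refine Polynomial.eq_of_infinite_eval_eq _ _
    (Set.infinite_of_injective_forall_mem (f := fun k : ℕ => ((k + 1 : ℕ) : ℝ)) ?_ ?_)
  · intro a b h
    simpa using h
  · intro k
    exact (hp _ k.succ_pos).trans (chromaticPoly_eval G _ k.succ_pos).symm

/-- `ε(G, x) = P'(G, x) / P(G, x)`. -/
noncomputable def chromaticEps {V : Type*} [Finite V] (G : SimpleGraph V) (x : ℝ) : ℝ :=
  (derivative (chromaticPoly G)).eval x / (chromaticPoly G).eval x

/-- The number `a_i(G)` in `P(G, x) = ∑ i, (-1) ^ (n - i) * a_i(G) * x ^ i`, for `i ≤ n`, where `n`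
is the order of `G`. -/
noncomputable def chromaticCoeff {V : Type*} [Finite V] (G : SimpleGraph V) (i : ℕ) : ℝ :=
  (-1) ^ (Nat.card V - i) * (chromaticPoly G).coeff i

/-- `ε(G) = ∑ (n - i) a_i / ∑ a_i`, both sums over `1 ≤ i ≤ n`, with `n` the order of `G`. -/
noncomputable def meanSize {V : Type*} [Finite V] (G : SimpleGraph V) : ℝ :=
  (∑ i ∈ Finset.Icc 1 (Nat.card V), ((Nat.card V : ℝ) - i) * chromaticCoeff G i) /
    ∑ i ∈ Finset.Icc 1 (Nat.card V), chromaticCoeff G i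

/-! For a vertex set `T` let U(T) = `numRooted G T`, counting acyclic orientations of the induced
subgraph with a unique source. Under subset convolution, k-colorings are the k-th power of the
indicator of independent sets, and the signed U is the logarithmic derivative of that indicator with
respect to the derivation f(S) ↦ |S| f(S). Hence, with P_S the chromatic polynomial of the subgraph
induced by S, Q(S) = (-1)^|S| P_S(-y) satisfies |S| Q(S) = y ∑_T U(T) Q(S \ T)
(`card_mul_inducedPoly`), and for y > 0 everything in sight is positive.

The claim becomes Q'(S) ≥ H(|S|) Q(S), where H(n) = ∑_{i<n} 1/(y+i) is the value attained by the
complete graph. Induction on S through the recursion (`IsSetExp.harmonicShift_mul_le`) reduces it to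
an inequality for U alone: j U(T) ≤ ∑_{1≤|R|≤j} U(R) U(T \ R) for j < |T|. For the complete graph
U(T) = |T|! and equality holds. In general, cutting a rooted orientation along the set reachable
from a vertex is an injection that proves it (`mul_numRooted_le`). A nonadjacent pair has U = 0,
while its two singletons have U = 1; this makes the inequality strict. -/

namespace ChromaticPoly

/-! ### Sums over subsets -/

section SetSums

variable {V M : Type*} [DecidableEq V] [AddCommMonoid M]

theorem sum_powerset_sdiff_comm (S : Finset V) (F : Finset V → Finset V → M) :
    ∑ A ∈ S.powerset, ∑ B ∈ (S \ A).powerset, F A B =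
      ∑ B ∈ S.powerset, ∑ A ∈ (S \ B).powerset, F A B := by
  refine Finset.sum_comm' fun A B => ?_
  simp only [Finset.mem_powerset, Finset.subset_sdiff]
  constructor
  · rintro ⟨hA, hB, h⟩
    exact ⟨⟨hA, h.symm⟩, hB⟩
  · rintro ⟨⟨hA, h⟩, hB⟩
    exact ⟨hA, hB, h.symm⟩

/-- Both sides run over ordered pairs of disjoint subsets (R, A) of `S`, with T = R ∪ A. -/
theorem sum_powerset_powerset (S : Finset V) (F : Finset V → Finset V → M) :
    ∑ T ∈ S.powerset, ∑ R ∈ T.powerset, F R (T \ R) =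
      ∑ R ∈ S.powerset, ∑ A ∈ (S \ R).powerset, F R A := by
  have h : ∑ T ∈ S.powerset, ∑ R ∈ T.powerset, F R (T \ R) =
      ∑ R ∈ S.powerset, ∑ T ∈ Finset.Icc R S, F R (T \ R) := by
    refine Finset.sum_comm' fun T R => ?_
    simp only [Finset.mem_powerset, Finset.mem_Icc]
    constructor
    · rintro ⟨hT, hR⟩
      exact ⟨⟨hR, hT⟩, hR.trans hT⟩
    · rintro ⟨⟨hR, hT⟩, -⟩
      exact ⟨hT, hR⟩
  rw [h]
  refine Finset.sum_congr rfl fun R hR => ?_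
  rw [Finset.mem_powerset] at hR
  refine Finset.sum_nbij' (fun T => T \ R) (fun A => R ∪ A) ?_ ?_ ?_ ?_ ?_
  · intro T hT
    simp only [Finset.mem_Icc] at hT
    simpa using Finset.sdiff_subset_sdiff hT.2 (Finset.Subset.refl R)
  · intro A hA
    simp only [Finset.mem_powerset, Finset.subset_sdiff] at hA
    simpa using Finset.union_subset hR hA.1
  · intro T hT
    simp only [Finset.mem_Icc] at hT
    simpa using hT.1
  · intro A hA
    simp only [Finset.mem_powerset, Finset.subset_sdiff] at hA
    exact Finset.union_sdiff_cancel_left hA.2.symm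
  · intro T _
    rfl

/-- If X is properly contained in Y, toggling an element of Y \ X cancels the sum; if X is not
contained in Y, the interval is empty. -/
theorem sum_Icc_neg_one_pow_card (X Y : Finset V) :
    ∑ T ∈ Finset.Icc X Y, (-1 : ℝ) ^ T.card = if X = Y then (-1) ^ X.card else 0 := by
  by_cases h : X ⊆ Y
  · rw [Finset.Icc_eq_image_powerset h, Finset.sum_image]
    · have h1 : ∀ A ∈ (Y \ X).powerset, (-1 : ℝ) ^ (X ∪ A).card =
          (-1) ^ X.card * (-1) ^ A.card := by
        intro A hA
        simp only [Finset.mem_powerset, Finset.subset_sdiff] at hA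
        rw [Finset.card_union_of_disjoint hA.2.symm, pow_add]
      rw [Finset.sum_congr rfl h1, ← Finset.mul_sum]
      have h2 := congrArg (Int.cast : ℤ → ℝ)
        (Finset.sum_powerset_neg_one_pow_card (x := Y \ X))
      push_cast at h2
      rw [h2]
      have h3 : Y \ X = ∅ ↔ X = Y := by
        rw [Finset.sdiff_eq_empty_iff_subset]
        exact ⟨fun h' => h.antisymm h', fun h' => h'.symm.subset⟩
      by_cases h4 : X = Y <;> simp [h3, h4]
    · intro A hA B hB hAB
      simp only [Finset.coe_powerset, Set.mem_preimage, Set.mem_powerset_iff,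
        Finset.coe_subset, Finset.subset_sdiff] at hA hB
      have := congrArg (· \ X) hAB
      simpa [Finset.union_sdiff_cancel_left hA.2.symm,
        Finset.union_sdiff_cancel_left hB.2.symm] using this
  · rw [Finset.Icc_eq_empty (by simpa using h), if_neg (fun h' => h h'.subset)]
    simp

end SetSums

/-! ### Logarithmic derivatives of exponentials of set functions -/

section Inequality

/-- Abel summation: only the partial sums of `d` need be nonnegative, not its terms. -/
theorem antitone_mul_sum_le_sum_mul {w d : ℕ → ℝ} (hw : Antitone w) (m : ℕ)
    (hd : ∀ j ≤ m, 0 ≤ ∑ k ∈ Finset.range j, d k) :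
    w m * ∑ k ∈ Finset.range m, d k ≤ ∑ k ∈ Finset.range m, w k * d k := by
  induction m with
  | zero => simp
  | succ m ih =>
    have h1 := ih fun j hj => hd j (hj.trans m.le_succ)
    have h2 := mul_le_mul_of_nonneg_right (hw m.le_succ) (hd (m + 1) le_rfl)
    rw [Finset.sum_range_succ] at h2 ⊢
    rw [Finset.sum_range_succ]
    simp only [Nat.succ_eq_add_one] at h2
    nlinarith

/-- The logarithmic derivative at `y` of the rising factorial `y (y + 1) ⋯ (y + n - 1)`. -/
noncomputable def harmonicShift (y : ℝ) (n : ℕ) : ℝ := ∑ i ∈ Finset.range n, 1 / (y + i)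

theorem harmonicShift_add (y : ℝ) (m t : ℕ) :
    harmonicShift y (m + (t + 1)) = harmonicShift y m + 1 / (y + m) +
      ∑ k ∈ Finset.range t, 1 / (y + m + (k + 1 : ℕ)) := by
  rw [harmonicShift, Finset.sum_range_add, Finset.sum_range_succ', harmonicShift]
  push_cast
  simp only [add_zero, add_assoc]
  rw [add_comm (∑ k ∈ Finset.range t, _)]

variable {V : Type*} [DecidableEq V] {U : Finset V → ℝ}

/-- Abel summation against the decreasing weights 1/(c+k+1), where d_k is the excess over U(T) of
the terms with |R| = k+1. -/
theorem mul_sum_one_div_le_sum_powerset (U0 : U ∅ = 0) {T : Finset V}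
    (hU : ∀ j, j + 1 ≤ T.card → j * U T ≤
      ∑ k ∈ Finset.range j, ∑ R ∈ T.powersetCard (k + 1), U R * U (T \ R))
    {c : ℝ} (hc : 0 < c) {t : ℕ} (ht : T.card = t + 1) :
    U T * ∑ k ∈ Finset.range t, 1 / (c + (k + 1 : ℕ)) ≤
      ∑ R ∈ T.powerset, U R * U (T \ R) / (c + R.card) := by
  have hw : Antitone fun k : ℕ => 1 / (c + (k + 1 : ℕ)) := by
    intro a b hab
    have : (a : ℝ) ≤ b := by exact_mod_cast hab
    simp only [Nat.cast_add, Nat.cast_one]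
    gcongr
  let a : ℕ → ℝ := fun k => ∑ R ∈ T.powersetCard (k + 1), U R * U (T \ R)
  have hd : ∀ j ≤ t, 0 ≤ ∑ k ∈ Finset.range j, (a k - U T) := by
    intro j hj
    have := hU j (by omega)
    simp only [Finset.sum_sub_distrib, Finset.sum_const, Finset.card_range, nsmul_eq_mul]
    exact sub_nonneg.2 this
  have h1 := antitone_mul_sum_le_sum_mul hw t hd
  have h2 : 0 ≤ 1 / (c + (t + 1 : ℕ)) * ∑ k ∈ Finset.range t, (a k - U T) :=
    mul_nonneg (by positivity) (hd t le_rfl)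
  have h3 : ∑ R ∈ T.powerset, U R * U (T \ R) / (c + R.card) =
      ∑ k ∈ Finset.range t, 1 / (c + (k + 1 : ℕ)) * a k := by
    rw [Finset.sum_powerset, ht, Finset.sum_range_succ, Finset.sum_range_succ']
    have e1 : T.powersetCard (t + 1) = {T} := by rw [← ht, Finset.powersetCard_self]
    rw [e1]
    -- The extreme terms R = ∅ and R = T vanish because U(∅) = 0.
    simp only [Finset.powersetCard_zero, Finset.sum_singleton, U0, sdiff_self, Finset.bot_eq_empty,
      zero_mul, mul_zero, zero_div, add_zero]
    refine Finset.sum_congr rfl fun k _ => ?_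
    rw [Finset.mul_sum]
    refine Finset.sum_congr rfl fun R hR => ?_
    rw [(Finset.mem_powersetCard.1 hR).2]
    ring
  rw [h3, Finset.mul_sum, ← sub_nonneg, ← Finset.sum_sub_distrib]
  refine (h2.trans h1).trans_eq (Finset.sum_congr rfl fun k _ => ?_)
  ring

/-- The data of the exponential formula for set functions, evaluated at a point `y`:
`Q` is the exponential of `y` times the set function `U T / |T|`, and `Q'` is its derivative. -/
structure IsSetExp (U : Finset V → ℝ) (y : ℝ) (Q Q' : Finset V → ℝ) : Prop where
  empty : Q ∅ = 1
  deriv_empty : Q' ∅ = 0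
  card_mul : ∀ S, S.card * Q S = y * ∑ T ∈ S.powerset, U T * Q (S \ T)
  card_mul_deriv : ∀ S, S.card * Q' S = ∑ T ∈ S.powerset, U T * Q (S \ T) +
    y * ∑ T ∈ S.powerset, U T * Q' (S \ T)

theorem IsSetExp.pos {y : ℝ} {Q Q' : Finset V → ℝ} (h : IsSetExp U y Q Q') (hy : 0 < y)
    (U0 : U ∅ = 0) (U1 : ∀ v, U {v} = 1) (hU : ∀ S, 0 ≤ U S) (S : Finset V) : 0 < Q S := by
  induction S using Finset.strongInduction with
  | _ S ih =>
  rcases S.eq_empty_or_nonempty with rfl | ⟨v, hv⟩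
  · simp [h.empty]
  have hterm : ∀ T ∈ S.powerset, 0 ≤ U T * Q (S \ T) := by
    intro T hT
    rcases T.eq_empty_or_nonempty with rfl | hT'
    · simp [U0]
    · exact mul_nonneg (hU T) (ih _ (Finset.sdiff_ssubset (Finset.mem_powerset.1 hT) hT')).le
  have hvS : {v} ∈ S.powerset := by simpa using hv
  have h1 : 0 < ∑ T ∈ S.powerset, U T * Q (S \ T) := by
    refine Finset.sum_pos' hterm ⟨{v}, hvS, ?_⟩
    rw [U1, one_mul]
    exact ih _ (Finset.sdiff_ssubset (Finset.mem_powerset.1 hvS) ⟨v, by simp⟩)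
  have h2 : 0 < (S.card : ℝ) * Q S := by
    rw [h.card_mul]
    exact mul_pos hy h1
  exact pos_of_mul_pos_right h2 (Nat.cast_nonneg _)

/-- Group the double sum by A = T \ R. The denominator is then y + |S \ A|, and the sum over R is
the recursion for S \ A, giving |S \ A| Q(S \ A). Together with the single sum, the numerator y + |S
\ A| cancels the denominator. -/
theorem IsSetExp.sum_eq {y : ℝ} {Q Q' : Finset V → ℝ} (h : IsSetExp U y Q Q') (hy : 0 < y)
    (S : Finset V) :
    ∑ T ∈ S.powerset, (y * Q (S \ T)) * (U T / (y + (S \ T).card) +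
        ∑ R ∈ T.powerset, U R * U (T \ R) / (y + (S \ T).card + R.card)) =
      ∑ T ∈ S.powerset, U T * Q (S \ T) := by
  have key : ∑ T ∈ S.powerset, ∑ R ∈ T.powerset,
      (y * Q (S \ T)) * (U R * U (T \ R) / (y + (S \ T).card + R.card)) =
      ∑ A ∈ S.powerset, U A * ((S \ A).card * Q (S \ A)) / (y + (S \ A).card) := by
    obtain ⟨F, hF⟩ : ∃ F : Finset V → Finset V → ℝ, ∀ R A, F R A =
        (y * Q ((S \ A) \ R)) * (U R * U A / (y + (S \ A).card)) := ⟨_, fun _ _ => rfl⟩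
    have e1 : ∑ T ∈ S.powerset, ∑ R ∈ T.powerset,
        (y * Q (S \ T)) * (U R * U (T \ R) / (y + (S \ T).card + R.card)) =
        ∑ T ∈ S.powerset, ∑ R ∈ T.powerset, F R (T \ R) := by
      refine Finset.sum_congr rfl fun T hT => Finset.sum_congr rfl fun R hR => ?_
      rw [Finset.mem_powerset] at hT hR
      have e2 : (S \ (T \ R)) \ R = S \ T := by
        ext x
        simp only [Finset.mem_sdiff]
        have := @hR x
        tauto
      have e3 : ((S \ (T \ R)).card : ℝ) = (S \ T).card + R.card := by
        have hRS : R ⊆ S \ (T \ R) := by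
          intro x hx
          simp only [Finset.mem_sdiff]
          exact ⟨hT (hR hx), fun h => h.2 hx⟩
        have := Finset.card_sdiff_add_card_eq_card hRS
        rw [e2] at this
        exact_mod_cast this.symm
      simp only [hF, e2, e3, add_assoc]
    rw [e1, sum_powerset_powerset, sum_powerset_sdiff_comm]
    refine Finset.sum_congr rfl fun A _ => ?_
    rw [h.card_mul, Finset.mul_sum, Finset.mul_sum, Finset.sum_div]
    refine Finset.sum_congr rfl fun R _ => ?_
    rw [hF]
    ring
  simp only [mul_add, Finset.sum_add_distrib, Finset.mul_sum]
  rw [key, ← Finset.sum_add_distrib]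
  refine Finset.sum_congr rfl fun T _ => ?_
  have : y + ((S \ T).card : ℝ) ≠ 0 := by positivity
  field_simp

variable {y : ℝ} {Q Q' : Finset V → ℝ}

/-- The difference of harmonic sums has |T| terms: the first is kept as it is, and the others are
bounded by the Abel summation with c = y + |S \ T|. -/
theorem mul_harmonicShift_sub_le (U0 : U ∅ = 0) {S T : Finset V} (hT : T ⊆ S)
    (hU : ∀ j, j + 1 ≤ T.card → j * U T ≤
      ∑ k ∈ Finset.range j, ∑ R ∈ T.powersetCard (k + 1), U R * U (T \ R)) (hy : 0 < y) :
    U T * (harmonicShift y S.card - harmonicShift y (S \ T).card) ≤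
      U T / (y + (S \ T).card) +
        ∑ R ∈ T.powerset, U R * U (T \ R) / (y + (S \ T).card + R.card) := by
  rcases T.eq_empty_or_nonempty with rfl | hT'
  · simp [U0]
  obtain ⟨t, ht⟩ : ∃ t, T.card = t + 1 := ⟨T.card - 1, by have := hT'.card_pos; omega⟩
  have h1 := mul_sum_one_div_le_sum_powerset U0 hU (c := y + (S \ T).card) (by positivity) ht
  rw [← Finset.card_sdiff_add_card_eq_card hT, ht, harmonicShift_add]
  calc _ = U T / (y + (S \ T).card) +
      U T * ∑ k ∈ Finset.range t, 1 / (y + (S \ T).card + (k + 1 : ℕ)) := by ring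
    _ ≤ _ := by gcongr

/-- A set function satisfying the partial sum inequalities of the complete graph has an exponential
whose logarithmic derivative is at least that of the rising factorial. -/
theorem IsSetExp.harmonicShift_mul_le (h : IsSetExp U y Q Q') (hy : 0 < y)
    (U0 : U ∅ = 0) (U1 : ∀ v, U {v} = 1) (hU : ∀ S, 0 ≤ U S)
    (hUU : ∀ T : Finset V, ∀ j, j + 1 ≤ T.card → j * U T ≤
      ∑ k ∈ Finset.range j, ∑ R ∈ T.powersetCard (k + 1), U R * U (T \ R)) (S : Finset V) :
    harmonicShift y S.card * Q S ≤ Q' S ∧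
      ((∃ T ⊆ S, T.card = 2 ∧ U T = 0) → harmonicShift y S.card * Q S < Q' S) := by
  induction S using Finset.strongInduction with
  | _ S ih =>
  rcases S.eq_empty_or_nonempty with rfl | hS
  · refine ⟨by simp [harmonicShift, h.deriv_empty], ?_⟩
    rintro ⟨T, hT, hT2, -⟩
    simp [Finset.subset_empty.1 hT] at hT2
  have hQ := h.pos hy U0 U1 hU
  set H := harmonicShift y S.card with hH
  have hn : (0 : ℝ) < S.card := by exact_mod_cast hS.card_pos
  have hIH : ∀ T ∈ S.powerset,
      U T * (harmonicShift y (S \ T).card * Q (S \ T)) ≤ U T * Q' (S \ T) := by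
    intro T hT
    rcases T.eq_empty_or_nonempty with rfl | hT'
    · simp [U0]
    · exact mul_le_mul_of_nonneg_left
        (ih _ (Finset.sdiff_ssubset (Finset.mem_powerset.1 hT) hT')).1 (hU T)
  have hstep : ∀ T ∈ S.powerset,
      (y * Q (S \ T)) * (U T * (H - harmonicShift y (S \ T).card)) ≤
      (y * Q (S \ T)) * (U T / (y + (S \ T).card) +
        ∑ R ∈ T.powerset, U R * U (T \ R) / (y + (S \ T).card + R.card)) := by
    intro T hT
    exact mul_le_mul_of_nonneg_left (mul_harmonicShift_sub_le U0 (Finset.mem_powerset.1 hT)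
      (hUU T) hy) (mul_nonneg hy.le (hQ _).le)
  have hsum := h.sum_eq hy S
  -- Expanding by both recursions and splitting H as (H - H(|S \ T|)) + H(|S \ T|) separates the
  -- part governed by `hstep` from the part governed by the induction hypothesis.
  have e : S.card * (Q' S - H * Q S) = (∑ T ∈ S.powerset, U T * Q (S \ T) -
      ∑ T ∈ S.powerset, (y * Q (S \ T)) * (U T * (H - harmonicShift y (S \ T).card))) +
      y * (∑ T ∈ S.powerset, U T * Q' (S \ T) -
        ∑ T ∈ S.powerset, U T * (harmonicShift y (S \ T).card * Q (S \ T))) := by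
    have e1 : S.card * (Q' S - H * Q S) = S.card * Q' S - H * (S.card * Q S) := by ring
    rw [e1, h.card_mul, h.card_mul_deriv]
    have e2 : ∑ T ∈ S.powerset, (y * Q (S \ T)) * (U T * (H - harmonicShift y (S \ T).card)) =
        H * (y * ∑ T ∈ S.powerset, U T * Q (S \ T)) -
          y * ∑ T ∈ S.powerset, U T * (harmonicShift y (S \ T).card * Q (S \ T)) := by
      simp only [Finset.mul_sum, ← Finset.sum_sub_distrib]
      refine Finset.sum_congr rfl fun T _ => ?_
      ring
    rw [e2]
    ring
  have hy' := mul_nonneg hy.le (sub_nonneg.2 (Finset.sum_le_sum hIH))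
  constructor
  · have h1 := Finset.sum_le_sum hstep
    rw [hsum] at h1
    have : 0 ≤ S.card * (Q' S - H * Q S) := by rw [e]; linarith
    linarith [nonneg_of_mul_nonneg_right this hn]
  · rintro ⟨T, hT, hT2, hUT⟩
    -- At this `T` the left side is zero, while splitting it into singletons makes the right side
    -- positive.
    have h1 := Finset.sum_lt_sum hstep ⟨T, Finset.mem_powerset.2 hT, by
      refine mul_lt_mul_of_pos_left ?_ (mul_pos hy (hQ _))
      rw [hUT, zero_mul, zero_div, zero_add]
      obtain ⟨a, b, hab, rfl⟩ := Finset.card_eq_two.1 hT2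
      refine Finset.sum_pos' (fun R _ => ?_) ⟨{a}, by simp, ?_⟩
      · have := hU R
        have := hU ({a, b} \ R)
        positivity
      · have : ({a, b} : Finset V) \ {a} = {b} := by
          ext x
          simp only [Finset.mem_sdiff, Finset.mem_insert, Finset.mem_singleton]
          constructor
          · tauto
          · rintro rfl
            exact ⟨Or.inr rfl, hab.symm⟩
        rw [this, U1, U1]
        positivity⟩
    rw [hsum] at h1
    have : 0 < S.card * (Q' S - H * Q S) := by rw [e]; linarith
    linarith [pos_of_mul_pos_right this hn.le]

end Inequality

/-! ### Acyclic orientations with a unique source -/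

section Orientations

variable {V : Type*} (G : SimpleGraph V)

/-- `O` is an acyclic orientation of the subgraph of `G` induced by `S`. -/
structure IsAcyclicOrientation (S : Finset V) (O : V → V → Prop) : Prop where
  adj : ∀ {a b}, O a b → G.Adj a b
  left_mem : ∀ {a b}, O a b → a ∈ S
  right_mem : ∀ {a b}, O a b → b ∈ S
  total : ∀ {a b}, a ∈ S → b ∈ S → G.Adj a b → O a b ∨ O b a
  rank : ∃ f : V → ℕ, ∀ a b, O a b → f a < f b

/-- The restriction of a relation to a set of vertices. -/
def restrictRel (O : V → V → Prop) (R : Finset V) : V → V → Prop :=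
  fun a b => O a b ∧ a ∈ R ∧ b ∈ R

variable {G}

theorem IsAcyclicOrientation.restrict {S R : Finset V} {O : V → V → Prop}
    (h : IsAcyclicOrientation G S O) (hR : R ⊆ S) :
    IsAcyclicOrientation G R (restrictRel O R) where
  adj hab := h.adj hab.1
  left_mem hab := hab.2.1
  right_mem hab := hab.2.2
  total ha hb hab := (h.total (hR ha) (hR hb) hab).imp (⟨·, ha, hb⟩) (⟨·, hb, ha⟩)
  rank := h.rank.imp fun _ hf a b hab => hf a b hab.1

section Extend

variable [DecidableEq V]

/-- Orient all edges between `T` and `S \ T` towards `S \ T`. -/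
def extendRel (G : SimpleGraph V) (O : V → V → Prop) (S T : Finset V) : V → V → Prop :=
  fun a b => O a b ∨ (a ∈ T ∧ b ∈ S \ T ∧ G.Adj a b)

theorem IsAcyclicOrientation.extend {S T : Finset V} {O : V → V → Prop}
    (h : IsAcyclicOrientation G T O) (hT : T ⊆ S)
    (hI : G.IsIndepSet (S \ T : Finset V)) : IsAcyclicOrientation G S (extendRel G O S T) where
  adj := by
    rintro a b (hab | hab)
    exacts [h.adj hab, hab.2.2]
  left_mem := by
    rintro a b (hab | hab)
    exacts [hT (h.left_mem hab), hT hab.1]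
  right_mem := by
    rintro a b (hab | hab)
    exacts [hT (h.right_mem hab), (Finset.mem_sdiff.1 hab.2.1).1]
  total := by
    intro a b ha hb hab
    by_cases haT : a ∈ T <;> by_cases hbT : b ∈ T
    · exact (h.total haT hbT hab).imp Or.inl Or.inl
    · exact Or.inl (Or.inr ⟨haT, Finset.mem_sdiff.2 ⟨hb, hbT⟩, hab⟩)
    · exact Or.inr (Or.inr ⟨hbT, Finset.mem_sdiff.2 ⟨ha, haT⟩, hab.symm⟩)
    · exact absurd hab (hI (Finset.mem_coe.2 (Finset.mem_sdiff.2 ⟨ha, haT⟩))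
        (Finset.mem_coe.2 (Finset.mem_sdiff.2 ⟨hb, hbT⟩)) hab.ne)
  rank := by
    obtain ⟨f, hf⟩ := h.rank
    -- The vertices outside `T` have no edges among themselves, so they can share one rank above all
    -- of `T`.
    refine ⟨fun x => if x ∈ T then f x else T.sup f + 1, ?_⟩
    rintro a b (hab | ⟨ha, hb, -⟩)
    · simpa [h.left_mem hab, h.right_mem hab] using hf _ _ hab
    · simpa [ha, (Finset.mem_sdiff.1 hb).2] using Nat.lt_succ_of_le (Finset.le_sup ha)

end Extend

section ReachSet

variable [Fintype V]

open scoped Classical in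
/-- The set of vertices that can be reached from `x`. -/
noncomputable def reachSet (O : V → V → Prop) (x : V) : Finset V :=
  {z | Relation.ReflTransGen O x z}

theorem mem_reachSet {O : V → V → Prop} {x z : V} :
    z ∈ reachSet O x ↔ Relation.ReflTransGen O x z := by
  simp [reachSet]

theorem reachSet_closed {O : V → V → Prop} {x a b : V} (ha : a ∈ reachSet O x) (hab : O a b) :
    b ∈ reachSet O x :=
  mem_reachSet.2 ((mem_reachSet.1 ha).tail hab)

theorem reachSet_subset {S : Finset V} {O : V → V → Prop} (h : IsAcyclicOrientation G S O)
    {x : V} (hx : x ∈ S) : reachSet O x ⊆ S := by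
  intro z hz
  rcases (mem_reachSet.1 hz).cases_tail with rfl | ⟨w, -, hw⟩
  · exact hx
  · exact h.right_mem hw

end ReachSet

variable (G) [Fintype V] [DecidableEq V]

open scoped Classical in
/-- The acyclic orientations of the subgraph induced by `S` that have no source besides `v`. -/
noncomputable def rootedOrientations (S : Finset V) (v : V) : Finset (V → V → Prop) :=
  {O | IsAcyclicOrientation G S O ∧ ∀ x ∈ S, x ≠ v → ∃ z, O z x}

variable {G} in
theorem mem_rootedOrientations {S : Finset V} {v : V} {O : V → V → Prop} :
    O ∈ rootedOrientations G S v ↔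
      IsAcyclicOrientation G S O ∧ ∀ x ∈ S, x ≠ v → ∃ z, O z x := by
  simp [rootedOrientations]

/-- The number of pairs of a vertex `v` in `S` and an acyclic orientation of the subgraph induced
by `S` whose only source is `v`. -/
noncomputable def numRooted (S : Finset V) : ℕ := (S.sigma (rootedOrientations G S)).card

theorem numRooted_eq_sum (S : Finset V) :
    numRooted G S = ∑ v ∈ S, (rootedOrientations G S v).card := Finset.card_sigma _ _

theorem numRooted_empty : numRooted G ∅ = 0 := by simp [numRooted]

theorem numRooted_singleton (v : V) : numRooted G {v} = 1 := by
  rw [numRooted_eq_sum, Finset.sum_singleton, Finset.card_eq_one]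
  refine ⟨fun _ _ => False, ?_⟩
  ext O
  rw [mem_rootedOrientations, Finset.mem_singleton]
  constructor
  · rintro ⟨h, -⟩
    ext a b
    refine iff_false_intro fun hab => ?_
    have ha := Finset.mem_singleton.1 (h.left_mem hab)
    have hb := Finset.mem_singleton.1 (h.right_mem hab)
    exact (h.adj hab).ne (ha.trans hb.symm)
  · rintro rfl
    refine ⟨⟨False.elim, False.elim, False.elim, ?_, 0, by simp⟩, ?_⟩
    · intro a b ha hb hab
      exact absurd ((Finset.mem_singleton.1 ha).trans (Finset.mem_singleton.1 hb).symm) hab.ne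
    · intro x hx hxv
      exact absurd (Finset.mem_singleton.1 hx) hxv

theorem numRooted_pair {u v : V} (huv : u ≠ v) (h : ¬ G.Adj u v) : numRooted G {u, v} = 0 := by
  rw [numRooted, Finset.card_eq_zero, Finset.sigma_eq_empty]
  intro w hw
  rw [Finset.eq_empty_iff_forall_notMem]
  intro O hO
  obtain ⟨hO, hs⟩ := mem_rootedOrientations.1 hO
  have hno : ∀ a b, ¬ O a b := by
    intro a b hab
    have ha := hO.left_mem hab
    have hb := hO.right_mem hab
    have hadj := hO.adj hab
    simp only [Finset.mem_insert, Finset.mem_singleton] at ha hb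
    rcases ha with rfl | rfl <;> rcases hb with rfl | rfl
    · exact hadj.ne rfl
    · exact h hadj
    · exact h hadj.symm
    · exact hadj.ne rfl
  obtain ⟨x, hx, hxw⟩ : ∃ x ∈ ({u, v} : Finset V), x ≠ w := by
    by_cases hu : u = w
    · exact ⟨v, by simp, fun hv => huv (hu.trans hv.symm)⟩
    · exact ⟨u, by simp, hu⟩
  obtain ⟨z, hz⟩ := hs x hx hxw
  exact hno _ _ hz

section Reach

variable {G}

variable {S : Finset V} {O : V → V → Prop}

/-- If fewer than j vertices had a reach set of size at most j, take one of highest rank among the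
others. All it reaches, besides itself, has small reach set, so its own has at most j elements. -/
theorem le_card_filter_reachSet (h : IsAcyclicOrientation G S O) {j : ℕ} (hj : j ≤ S.card) :
    j ≤ (S.filter fun x => (reachSet O x).card ≤ j).card := by
  by_contra! hlt
  set L := S.filter fun x => (reachSet O x).card ≤ j with hL
  obtain ⟨f, hf⟩ := h.rank
  have hne : (S \ L).Nonempty := by
    rw [Finset.sdiff_nonempty]
    exact fun hSL => absurd (Finset.card_le_card hSL) (by omega)
  obtain ⟨m, hm, hmax⟩ := Finset.exists_max_image (S \ L) f hne
  rw [Finset.mem_sdiff] at hm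
  have hsub : reachSet O m ⊆ insert m L := by
    intro z hz
    rw [Finset.mem_insert]
    rcases (mem_reachSet.1 hz).cases_head with rfl | ⟨c, hmc, hcz⟩
    · exact Or.inl rfl
    refine Or.inr ?_
    by_contra hzL
    have hzS := reachSet_subset h hm.1 hz
    have h1 := hmax z (Finset.mem_sdiff.2 ⟨hzS, hzL⟩)
    have h2 : f c ≤ f z := by
      clear hz hzL hzS h1
      induction hcz with
      | refl => exact le_rfl
      | tail _ hbc ih => exact ih.trans (hf _ _ hbc).le
    have := hf _ _ hmc
    omega
  have h1 := (Finset.card_le_card hsub).trans (Finset.card_insert_le m L)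
  exact hm.2 (Finset.mem_filter.2 ⟨hm.1, by omega⟩)

/-- Following incoming edges backwards lowers the rank, so it must end at the only source. -/
theorem reachSet_eq_of_root (h : IsAcyclicOrientation G S O) {v : V} (hv : v ∈ S)
    (hs : ∀ x ∈ S, x ≠ v → ∃ z, O z x) : reachSet O v = S := by
  refine (reachSet_subset h hv).antisymm fun x hx => ?_
  obtain ⟨f, hf⟩ := h.rank
  induction hn : f x using Nat.strong_induction_on generalizing x with
  | _ n ih =>
  by_cases hxv : x = v
  · exact mem_reachSet.2 (hxv ▸ .refl)
  obtain ⟨z, hz⟩ := hs x hx hxv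
  exact reachSet_closed (ih (f z) (hn ▸ hf _ _ hz) z (h.left_mem hz) rfl) hz

theorem restrictRel_reachSet_mem (h : IsAcyclicOrientation G S O) {x : V} (hx : x ∈ S) :
    restrictRel O (reachSet O x) ∈ rootedOrientations G (reachSet O x) x := by
  refine mem_rootedOrientations.2 ⟨h.restrict (reachSet_subset h hx), fun z hz hzx => ?_⟩
  rcases (mem_reachSet.1 hz).cases_tail with rfl | ⟨w, hw, hwz⟩
  · exact absurd rfl hzx
  · exact ⟨w, hwz, mem_reachSet.2 hw, hz⟩

theorem restrictRel_sdiff_reachSet_mem (h : IsAcyclicOrientation G S O) {v x : V}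
    (hs : ∀ x ∈ S, x ≠ v → ∃ z, O z x) :
    restrictRel O (S \ reachSet O x) ∈ rootedOrientations G (S \ reachSet O x) v := by
  refine mem_rootedOrientations.2 ⟨h.restrict Finset.sdiff_subset, fun z hz hzv => ?_⟩
  obtain ⟨hzS, hzR⟩ := Finset.mem_sdiff.1 hz
  obtain ⟨w, hw⟩ := hs z hzS hzv
  exact ⟨w, hw, Finset.mem_sdiff.2 ⟨h.left_mem hw, fun hwR => hzR (reachSet_closed hwR hw)⟩, hz⟩

/-- A reach set is closed under outgoing edges, so every edge across its boundary points into it;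
only the two restrictions carry information. -/
theorem eq_of_restrictRel_eq {O' : V → V → Prop} (h : IsAcyclicOrientation G S O)
    (h' : IsAcyclicOrientation G S O') {x : V} (hR : reachSet O x = reachSet O' x)
    (h1 : restrictRel O (reachSet O x) = restrictRel O' (reachSet O x))
    (h2 : restrictRel O (S \ reachSet O x) = restrictRel O' (S \ reachSet O x)) : O = O' := by
  have aux : ∀ {P P' : V → V → Prop}, IsAcyclicOrientation G S P → IsAcyclicOrientation G S P' →
      reachSet P x = reachSet P' x →
      restrictRel P (reachSet P x) = restrictRel P' (reachSet P x) →
      restrictRel P (S \ reachSet P x) = restrictRel P' (S \ reachSet P x) →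
      ∀ a b, P a b → P' a b := by
    intro P P' hP hP' hR h1 h2 a b hab
    by_cases ha : a ∈ reachSet P x
    · have : restrictRel P (reachSet P x) a b := ⟨hab, ha, reachSet_closed ha hab⟩
      rw [h1] at this
      exact this.1
    by_cases hb : b ∈ reachSet P x
    · refine (hP'.total (hP.left_mem hab) (hP.right_mem hab) (hP.adj hab)).resolve_right ?_
      intro hba
      rw [hR] at ha hb
      exact ha (reachSet_closed hb hba)
    · have : restrictRel P (S \ reachSet P x) a b :=
        ⟨hab, Finset.mem_sdiff.2 ⟨hP.left_mem hab, ha⟩,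
          Finset.mem_sdiff.2 ⟨hP.right_mem hab, hb⟩⟩
      rw [h2] at this
      exact this.1
  ext a b
  refine ⟨aux h h' hR h1 h2 a b, aux h' h hR.symm ?_ ?_ a b⟩
  · rw [← hR, h1]
  · rw [← hR, h2]

end Reach

/-- Each orientation O rooted at v has at least j vertices x whose reach set R has at most j
elements. Cutting along R leaves orientations of R rooted at x and of T \ R rooted at v, and these
determine (v, O, x). -/
theorem mul_numRooted_le (T : Finset V) (j : ℕ) (hj : j + 1 ≤ T.card) :
    j * numRooted G T ≤ ∑ k ∈ Finset.range j, ∑ R ∈ T.powersetCard (k + 1),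
      numRooted G R * numRooted G (T \ R) := by
  have hrhs : ∑ k ∈ Finset.range j, ∑ R ∈ T.powersetCard (k + 1),
      numRooted G R * numRooted G (T \ R) =
      (((Finset.range j).biUnion fun k => T.powersetCard (k + 1)).sigma fun R =>
        (R.sigma (rootedOrientations G R)) ×ˢ
          ((T \ R).sigma (rootedOrientations G (T \ R)))).card := by
    rw [Finset.card_sigma, Finset.sum_biUnion]
    · simp only [Finset.card_product, numRooted]
    · intro a _ b _ hab
      exact Finset.pairwise_disjoint_powersetCard T (by simpa using hab)
  have hlhs : j * numRooted G T ≤ ((T.sigma (rootedOrientations G T)).sigma fun p =>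
      T.filter fun x => (reachSet p.2 x).card ≤ j).card := by
    rw [Finset.card_sigma, numRooted, mul_comm, ← smul_eq_mul]
    refine Finset.card_nsmul_le_sum _ _ _ fun p hp => ?_
    rw [Finset.mem_sigma, mem_rootedOrientations] at hp
    exact le_card_filter_reachSet hp.2.1 (by omega)
  rw [hrhs]
  refine hlhs.trans (Finset.card_le_card_of_injOn
    (fun q => ⟨reachSet q.1.2 q.2, ⟨q.2, restrictRel q.1.2 (reachSet q.1.2 q.2)⟩,
      ⟨q.1.1, restrictRel q.1.2 (T \ reachSet q.1.2 q.2)⟩⟩) ?_ ?_)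
  · rintro ⟨⟨v, O⟩, x⟩ hq
    simp only [Finset.coe_sigma, Set.mem_sigma_iff, Finset.mem_coe, mem_rootedOrientations,
      Finset.mem_filter] at hq
    obtain ⟨⟨hv, hO, hs⟩, hx, hcard⟩ := hq
    have hpos : 0 < (reachSet O x).card := Finset.card_pos.2 ⟨x, mem_reachSet.2 .refl⟩
    -- The root reaches all of `T`, which has more than `j` elements.
    have hvR : v ∉ reachSet O x := by
      intro hvx
      have : T ⊆ reachSet O x := by
        rw [← reachSet_eq_of_root hO hv hs]
        intro z hz
        exact mem_reachSet.2 ((mem_reachSet.1 hvx).trans (mem_reachSet.1 hz))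
      have := Finset.card_le_card this
      omega
    simp only [Finset.mem_coe, Finset.mem_sigma, Finset.mem_biUnion, Finset.mem_range,
      Finset.mem_powersetCard, Finset.mem_product]
    exact ⟨⟨(reachSet O x).card - 1, by omega, reachSet_subset hO hx, by omega⟩,
      ⟨mem_reachSet.2 .refl, restrictRel_reachSet_mem hO hx⟩,
      Finset.mem_sdiff.2 ⟨hv, hvR⟩, restrictRel_sdiff_reachSet_mem hO hs⟩
  · rintro ⟨⟨v, O⟩, x⟩ hq ⟨⟨v', O'⟩, x'⟩ hq' heq
    simp only [Finset.coe_sigma, Set.mem_sigma_iff, Finset.mem_coe, mem_rootedOrientations,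
      Finset.mem_filter] at hq hq'
    simp only [Sigma.mk.injEq, heq_eq_eq, Prod.mk.injEq] at heq
    obtain ⟨hR, ⟨rfl, h1⟩, rfl, h2⟩ := heq
    have := eq_of_restrictRel_eq hq.1.2.1 hq'.1.2.1 hR (by rw [h1, hR]) (by rw [h2, hR])
    subst this
    rfl

section Extend

variable {G}

-- Orienting all edges from T to the independent set S \ T makes the vertices of S \ T sinks.
-- Conversely, a set of sinks is independent and its edges are forced.
open scoped Classical in
theorem card_rootedOrientations_mul_indep {S T : Finset V} (hT : T ⊆ S) (v : V) :
    (rootedOrientations G T v).card * (if G.IsIndepSet (S \ T : Finset V) then 1 else 0) =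
      (Finset.univ.filter fun O => IsAcyclicOrientation G S O ∧ (∀ x ∈ S, (∃ z, O x z) → x ∈ T) ∧
        ∀ x ∈ T, x ≠ v → ∃ z, O z x).card := by
  split_ifs with hI
  · rw [mul_one]
    refine Finset.card_nbij' (fun O => extendRel G O S T) (fun O => restrictRel O T) ?_ ?_ ?_ ?_
    · intro O hO
      obtain ⟨hO, hs⟩ := mem_rootedOrientations.1 hO
      simp only [Finset.coe_filter, Finset.mem_univ, true_and, Set.mem_ofPred_eq]
      refine ⟨hO.extend hT hI, ?_, fun x hx hxv => ?_⟩
      · rintro x - ⟨z, hz | hz⟩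
        exacts [hO.left_mem hz, hz.1]
      · exact (hs x hx hxv).imp fun z hz => Or.inl hz
    · intro O hO
      simp only [Finset.coe_filter, Finset.mem_univ, true_and, Set.mem_ofPred_eq] at hO
      obtain ⟨hO, hsink, hs⟩ := hO
      refine mem_rootedOrientations.2 ⟨hO.restrict hT, fun x hx hxv => ?_⟩
      obtain ⟨z, hz⟩ := hs x hx hxv
      exact ⟨z, hz, hsink z (hO.left_mem hz) ⟨x, hz⟩, hx⟩
    · intro O hO
      obtain ⟨hO, -⟩ := mem_rootedOrientations.1 hO
      ext a b
      constructor
      · rintro ⟨hab | hab, -, hb⟩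
        · exact hab
        · exact absurd hb (Finset.mem_sdiff.1 hab.2.1).2
      · exact fun hab => ⟨Or.inl hab, hO.left_mem hab, hO.right_mem hab⟩
    · intro O hO
      simp only [Finset.coe_filter, Finset.mem_univ, true_and, Set.mem_ofPred_eq] at hO
      obtain ⟨hO, hsink, hs⟩ := hO
      ext a b
      constructor
      · rintro (hab | ⟨ha, hb, hab⟩)
        · exact hab.1
        · obtain ⟨hbS, hbT⟩ := Finset.mem_sdiff.1 hb
          exact (hO.total (hT ha) hbS hab).resolve_right fun hba => hbT (hsink b hbS ⟨a, hba⟩)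
      · intro hab
        have ha := hsink a (hO.left_mem hab) ⟨b, hab⟩
        by_cases hb : b ∈ T
        · exact Or.inl ⟨hab, ha, hb⟩
        · exact Or.inr ⟨ha, Finset.mem_sdiff.2 ⟨hO.right_mem hab, hb⟩, hO.adj hab⟩
  · rw [mul_zero, eq_comm, Finset.card_eq_zero, Finset.filter_eq_empty_iff]
    rintro O - ⟨hO, hsink, -⟩
    refine hI fun a ha b hb _ hab => ?_
    obtain ⟨haS, haT⟩ := Finset.mem_sdiff.1 (Finset.mem_coe.1 ha)
    obtain ⟨hbS, hbT⟩ := Finset.mem_sdiff.1 (Finset.mem_coe.1 hb)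
    rcases hO.total haS hbS hab with h | h
    · exact haT (hsink a haS ⟨b, h⟩)
    · exact hbT (hsink b hbS ⟨a, h⟩)

-- If an edge exists, take the lowest vertex m with an outgoing edge and the highest vertex M with
-- an incoming one. Then m has no incoming and M no outgoing edge, so equality of the sets forces m
-- = v = M, which is absurd.
open scoped Classical in
theorem outSet_eq_inSet_iff {S : Finset V} {O : V → V → Prop} (hO : IsAcyclicOrientation G S O)
    (v : V) :
    insert v (S.filter fun x => ∃ z, O x z) = insert v (S.filter fun x => ∃ z, O z x) ↔
      ∀ a b, ¬ O a b := by
  constructor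
  · intro h
    by_contra! hne
    obtain ⟨a, b, hab⟩ := hne
    obtain ⟨f, hf⟩ := hO.rank
    obtain ⟨m, hm, hmin⟩ := Finset.exists_min_image (S.filter fun x => ∃ z, O x z) f
      ⟨a, Finset.mem_filter.2 ⟨hO.left_mem hab, b, hab⟩⟩
    obtain ⟨M, hM, hmax⟩ := Finset.exists_max_image (S.filter fun x => ∃ z, O z x) f
      ⟨b, Finset.mem_filter.2 ⟨hO.right_mem hab, a, hab⟩⟩
    have hm' : ∀ z, ¬ O z m := fun z hz =>
      (hf _ _ hz).not_ge (hmin z (Finset.mem_filter.2 ⟨hO.left_mem hz, m, hz⟩))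
    have hM' : ∀ z, ¬ O M z := fun z hz =>
      (hf _ _ hz).not_ge (hmax z (Finset.mem_filter.2 ⟨hO.right_mem hz, M, hz⟩))
    have hmv : m = v := by
      have : m ∈ insert v (S.filter fun x => ∃ z, O z x) := h ▸ Finset.mem_insert_of_mem hm
      refine (Finset.mem_insert.1 this).resolve_right fun h' => ?_
      obtain ⟨z, hz⟩ := (Finset.mem_filter.1 h').2
      exact hm' z hz
    have hMv : M = v := by
      have : M ∈ insert v (S.filter fun x => ∃ z, O x z) :=
        h.symm ▸ Finset.mem_insert_of_mem hM
      refine (Finset.mem_insert.1 this).resolve_right fun h' => ?_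
      obtain ⟨z, hz⟩ := (Finset.mem_filter.1 h').2
      exact hM' z hz
    obtain ⟨z, hz⟩ := (Finset.mem_filter.1 hM).2
    exact hm' z (by rw [hmv, ← hMv]; exact hz)
  · intro h
    simp [h]

end Extend

-- Exchange the sums: a fixed orientation O of S is counted for the sets T in the interval from `X
-- O` to `Y O`. The alternating sum cancels unless O has no edges, which is possible exactly when S
-- is independent.
open scoped Classical in
theorem sum_rootedOrientations_indep {S : Finset V} {v : V} (hv : v ∈ S) :
    ∑ T ∈ S.powerset with v ∈ T, -(-1 : ℝ) ^ T.card * ((rootedOrientations G T v).card *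
      (if G.IsIndepSet (S \ T : Finset V) then 1 else 0)) =
      if G.IsIndepSet (S : Set V) then 1 else 0 := by
  let X : (V → V → Prop) → Finset V := fun O => insert v (S.filter fun x => ∃ z, O x z)
  let Y : (V → V → Prop) → Finset V := fun O => insert v (S.filter fun x => ∃ z, O z x)
  have h1 : ∀ T ∈ S.powerset.filter (v ∈ ·), -(-1 : ℝ) ^ T.card *
      ((rootedOrientations G T v).card * (if G.IsIndepSet (S \ T : Finset V) then 1 else 0)) =
      ∑ O with IsAcyclicOrientation G S O, if T ∈ Finset.Icc (X O) (Y O) then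
        -(-1 : ℝ) ^ T.card else 0 := by
    intro T hT
    obtain ⟨hTS, hvT⟩ := Finset.mem_filter.1 hT
    rw [Finset.mem_powerset] at hTS
    have h2 := congrArg (Nat.cast : ℕ → ℝ) (card_rootedOrientations_mul_indep (G := G) hTS v)
    rw [Nat.cast_mul, Nat.cast_ite, Nat.cast_one, Nat.cast_zero] at h2
    rw [h2, ← Finset.sum_filter, Finset.filter_filter, Finset.sum_const, nsmul_eq_mul, mul_comm]
    congr 3
    ext O
    simp only [Finset.mem_filter, Finset.mem_univ, true_and, Finset.mem_Icc, X, Y]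
    refine and_congr_right fun hO => and_congr ?_ ?_
    · constructor
      · intro h
        refine Finset.insert_subset hvT fun x hx => ?_
        exact h x (Finset.mem_filter.1 hx).1 (Finset.mem_filter.1 hx).2
      · exact fun h x hx hz => h (Finset.mem_insert_of_mem (Finset.mem_filter.2 ⟨hx, hz⟩))
    · constructor
      · intro h x hx
        by_cases hxv : x = v
        · exact Finset.mem_insert.2 (Or.inl hxv)
        · exact Finset.mem_insert_of_mem (Finset.mem_filter.2 ⟨hTS hx, h x hx hxv⟩)
      · intro h x hx hxv
        exact (Finset.mem_filter.1 ((Finset.mem_insert.1 (h hx)).resolve_left hxv)).2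
  rw [Finset.sum_congr rfl h1, Finset.sum_comm]
  have h3 : ∀ O ∈ (Finset.univ.filter fun O => IsAcyclicOrientation G S O),
      (∑ T ∈ S.powerset with v ∈ T, if T ∈ Finset.Icc (X O) (Y O) then -(-1 : ℝ) ^ T.card else 0) =
      if ∀ a b, ¬ O a b then 1 else 0 := by
    intro O hO
    have hO := (Finset.mem_filter.1 hO).2
    have hsub : (S.powerset.filter (v ∈ ·)).filter (· ∈ Finset.Icc (X O) (Y O)) =
        Finset.Icc (X O) (Y O) := by
      ext T
      simp only [Finset.mem_filter, Finset.mem_powerset, and_iff_right_iff_imp, Finset.mem_Icc]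
      intro hT
      exact ⟨hT.2.trans (Finset.insert_subset hv (Finset.filter_subset _ _)),
        hT.1 (Finset.mem_insert_self _ _)⟩
    rw [← Finset.sum_filter, hsub, Finset.sum_neg_distrib, sum_Icc_neg_one_pow_card]
    have h4 := outSet_eq_inSet_iff hO v
    by_cases h5 : ∀ a b, ¬ O a b
    · rw [if_pos (h4.2 h5), if_pos h5]
      -- Here `X O` = {v}, and the sign is -(-1)^1 = 1.
      simp [X, h5]
    · rw [if_neg (fun h => h5 (h4.1 h)), if_neg h5, neg_zero]
  rw [Finset.sum_congr rfl h3, ← Finset.sum_filter, Finset.filter_filter, Finset.sum_const,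
    nsmul_eq_mul, mul_one]
  split_ifs with hI
  · rw [Nat.cast_eq_one, Finset.card_eq_one]
    refine ⟨fun _ _ => False, ?_⟩
    ext O
    simp only [Finset.mem_filter, Finset.mem_univ, true_and, Finset.mem_singleton]
    constructor
    · rintro ⟨-, h⟩
      ext a b
      exact iff_false_intro (h a b)
    · rintro rfl
      refine ⟨⟨False.elim, False.elim, False.elim, ?_, 0, by simp⟩, by simp⟩
      exact fun ha hb hab => absurd hab (hI ha hb hab.ne)
  · rw [Nat.cast_eq_zero, Finset.card_eq_zero, Finset.filter_eq_empty_iff]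
    rintro O - ⟨hO, h⟩
    refine hI fun a ha b hb _ hab => ?_
    rcases hO.total ha hb hab with h' | h'
    · exact h _ _ h'
    · exact h _ _ h'

open scoped Classical in
/-- The indicator function of the independent sets. -/
noncomputable def indep (S : Finset V) : ℝ := if G.IsIndepSet (S : Set V) then 1 else 0

/-- The number of rooted acyclic orientations, with sign, is the logarithmic derivative of the
indicator function of the independent sets in the algebra of set functions. -/
theorem sum_numRooted_indep (S : Finset V) :
    ∑ T ∈ S.powerset, -(-1 : ℝ) ^ T.card * numRooted G T * indep G (S \ T) =
      S.card * indep G S := by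
  have h1 : ∀ T ∈ S.powerset, -(-1 : ℝ) ^ T.card * numRooted G T * indep G (S \ T) =
      ∑ v ∈ T, -(-1 : ℝ) ^ T.card * ((rootedOrientations G T v).card * indep G (S \ T)) := by
    intro T _
    rw [← Finset.mul_sum, ← Finset.sum_mul, numRooted_eq_sum]
    push_cast
    ring
  rw [Finset.sum_congr rfl h1]
  rw [Finset.sum_comm' (t' := S) (s' := fun v => S.powerset.filter (v ∈ ·))]
  · simp only [indep]
    rw [Finset.sum_congr rfl fun v hv => sum_rootedOrientations_indep G hv, Finset.sum_const,
      nsmul_eq_mul]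
  · intro T v
    simp only [Finset.mem_powerset, Finset.mem_filter]
    exact ⟨fun h => ⟨⟨h.1, h.2⟩, h.1 h.2⟩, fun h => ⟨h.1.1, h.1.2⟩⟩

end Orientations

/-! ### Colorings as convolution powers -/

section Colorings

variable {V : Type*} (G : SimpleGraph V)

/-- The number of proper colorings with `k` colors of the subgraph induced by `S`. -/
noncomputable def numColorings (S : Finset V) (k : ℕ) : ℕ :=
  Nat.card ((G.induce (S : Set V)).Coloring (Fin k))

theorem numColorings_zero {S : Finset V} (hS : S.Nonempty) : numColorings G S 0 = 0 := by
  obtain ⟨v, hv⟩ := hS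
  have : IsEmpty ((G.induce (S : Set V)).Coloring (Fin 0)) := ⟨fun C => (C ⟨v, hv⟩).elim0⟩
  exact Nat.card_of_isEmpty

theorem numColorings_empty (k : ℕ) : numColorings G ∅ k = 1 := by
  have : IsEmpty ((∅ : Finset V) : Set V) := by simp
  rw [numColorings, Nat.card_eq_one_iff_unique]
  exact ⟨⟨fun a b => by ext x; exact isEmptyElim x⟩, ⟨.ofIsEmpty⟩⟩

variable [DecidableEq V]

/-- The colorings for which the last color is used exactly on `B` are the colorings of the
complement of `B` with the other colors. -/
noncomputable def coloringEquivOfLast (S B : Finset V)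
    (hI : G.IsIndepSet (B : Set V)) (k : ℕ) :
    {C : (G.induce (S : Set V)).Coloring (Fin (k + 1)) //
      ∀ v : (S : Set V), C v = Fin.last k ↔ (v : V) ∈ B} ≃
      (G.induce ((S \ B : Finset V) : Set V)).Coloring (Fin k) where
  toFun C := SimpleGraph.Coloring.mk
    (fun v => (C.1 ⟨v, (Finset.mem_sdiff.1 v.2).1⟩).castPred
      fun h => (Finset.mem_sdiff.1 v.2).2 ((C.2 _).1 h))
    (by
      intro v w hvw h
      rw [Fin.castPred_inj] at h
      exact C.1.valid (v := ⟨v, (Finset.mem_sdiff.1 v.2).1⟩)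
        (w := ⟨w, (Finset.mem_sdiff.1 w.2).1⟩) hvw h)
  invFun D := ⟨SimpleGraph.Coloring.mk
    (fun v => if h : (v : V) ∈ B then Fin.last k else
      (D ⟨v, Finset.mem_sdiff.2 ⟨v.2, h⟩⟩).castSucc)
    (by
      intro v w hvw
      have hvw' : G.Adj v w := hvw
      by_cases hv : (v : V) ∈ B <;> by_cases hw : (w : V) ∈ B
      · exact absurd hvw' (hI hv hw hvw'.ne)
      · simp only [hv, hw, dite_true, dite_false]
        exact (Fin.castSucc_ne_last _).symm
      · simp only [hv, hw, dite_true, dite_false]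
        exact Fin.castSucc_ne_last _
      · simp only [hv, hw, dite_false]
        intro h
        exact D.valid (v := ⟨v, Finset.mem_sdiff.2 ⟨v.2, hv⟩⟩)
          (w := ⟨w, Finset.mem_sdiff.2 ⟨w.2, hw⟩⟩) hvw (Fin.castSucc_injective _ h)),
    by
      intro v
      change (if h : (v : V) ∈ B then Fin.last k else
        (D ⟨v, Finset.mem_sdiff.2 ⟨v.2, h⟩⟩).castSucc) = Fin.last k ↔ _
      by_cases hv : (v : V) ∈ B
      · simp [hv]
      · simp only [hv, dite_false, iff_false]
        exact Fin.castSucc_ne_last _⟩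
  left_inv C := by
    refine Subtype.ext (RelHom.ext fun v => ?_)
    change (if h : (v : V) ∈ B then Fin.last k else _) = C.1 v
    by_cases hv : (v : V) ∈ B
    · rw [dif_pos hv]
      exact ((C.2 v).2 hv).symm
    · rw [dif_neg hv]
      exact Fin.castSucc_castPred (C.1 v) fun h => hv ((C.2 v).1 h)
  right_inv D := by
    refine RelHom.ext fun v => ?_
    have hv : (v : V) ∉ B := (Finset.mem_sdiff.1 v.2).2
    have h : (if h : (v : V) ∈ B then Fin.last k else
        (D ⟨v, Finset.mem_sdiff.2 ⟨(Finset.mem_sdiff.1 v.2).1, h⟩⟩).castSucc) =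
        (D v).castSucc := dif_neg hv
    exact Fin.castSucc_injective _ ((Fin.castSucc_castPred _
      (ne_of_eq_of_ne h (Fin.castSucc_ne_last _))).trans h)

/-- Sort the colorings by the class `B` of the last color. -/
theorem numColorings_succ [Fintype V] (S : Finset V) (k : ℕ) :
    (numColorings G S (k + 1) : ℝ) =
      ∑ B ∈ S.powerset, indep G B * numColorings G (S \ B) k := by
  classical
  have : Fintype ((G.induce (S : Set V)).Coloring (Fin (k + 1))) := Fintype.ofFinite _
  let cls : (G.induce (S : Set V)).Coloring (Fin (k + 1)) → Finset V := fun C =>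
    S.filter fun v => ∃ h : v ∈ S, C ⟨v, h⟩ = Fin.last k
  have hcls : ∀ C, ∀ B ⊆ S, cls C = B ↔
      ∀ v : (S : Set V), C v = Fin.last k ↔ (v : V) ∈ B := by
    intro C B hB
    rw [Finset.ext_iff]
    constructor
    · intro h v
      have hv : (v : V) ∈ S := v.2
      rw [← h v]
      simp only [cls, Finset.mem_filter]
      exact ⟨fun h => ⟨hv, hv, h⟩, fun h => h.2.2⟩
    · intro h v
      simp only [cls, Finset.mem_filter]
      constructor
      · rintro ⟨-, hv, h'⟩
        exact (h ⟨v, hv⟩).1 h'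
      · exact fun hv => ⟨hB hv, hB hv, (h ⟨v, hB hv⟩).2 hv⟩
  rw [numColorings, Nat.card_eq_fintype_card, ← Finset.card_univ,
    Finset.card_eq_sum_card_fiberwise (f := cls) (t := S.powerset)
      (fun C _ => Finset.mem_coe.2 (Finset.mem_powerset.2 (Finset.filter_subset _ _))),
    Nat.cast_sum]
  refine Finset.sum_congr rfl fun B hB => ?_
  rw [Finset.mem_powerset] at hB
  rw [Finset.filter_congr fun C _ => hcls C B hB, indep]
  split_ifs with hI
  · rw [one_mul, numColorings, ← Nat.card_congr (coloringEquivOfLast G S B hI k),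
      Nat.card_eq_fintype_card, Fintype.card_subtype]
  · rw [zero_mul, Nat.cast_eq_zero, Finset.card_eq_zero, Finset.filter_eq_empty_iff]
    intro C _ hC
    refine hI fun a ha b hb _ hab => ?_
    refine C.valid (v := ⟨a, hB ha⟩) (w := ⟨b, hB hb⟩) hab ?_
    rw [(hC ⟨a, hB ha⟩).2 ha, (hC ⟨b, hB hb⟩).2 hb]

/-- This is D(I^k) = k I^k (DI / I) in the convolution algebra, where I is `indep G`, D multiplies
by cardinality, and DI / I is the signed `numRooted`. The induction is the Leibniz rule for I · I^k:
`e1` treats the factor I and `e3` the factor I^k. -/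
theorem card_mul_numColorings [Fintype V] (S : Finset V) (k : ℕ) :
    (S.card : ℝ) * numColorings G S k =
      k * ∑ T ∈ S.powerset, -(-1 : ℝ) ^ T.card * numRooted G T * numColorings G (S \ T) k := by
  induction k generalizing S with
  | zero =>
    rcases S.eq_empty_or_nonempty with rfl | hS
    · simp
    · simp [numColorings_zero G hS]
  | succ k ih =>
    have e1 : ∑ B ∈ S.powerset, B.card * indep G B * numColorings G (S \ B) k =
        ∑ T ∈ S.powerset, -(-1 : ℝ) ^ T.card * numRooted G T *
          numColorings G (S \ T) (k + 1) := by
      obtain ⟨F, hF⟩ : ∃ F : Finset V → Finset V → ℝ, ∀ R A, F R A =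
        -(-1 : ℝ) ^ R.card * numRooted G R * indep G A * numColorings G (S \ (R ∪ A)) k :=
        ⟨_, fun _ _ => rfl⟩
      have e2 : ∑ B ∈ S.powerset, B.card * indep G B * numColorings G (S \ B) k =
          ∑ B ∈ S.powerset, ∑ R ∈ B.powerset, F R (B \ R) := by
        refine Finset.sum_congr rfl fun B _ => ?_
        rw [← sum_numRooted_indep, Finset.sum_mul]
        refine Finset.sum_congr rfl fun R hR => ?_
        rw [hF, Finset.union_sdiff_of_subset (Finset.mem_powerset.1 hR)]
      rw [e2, sum_powerset_powerset]
      refine Finset.sum_congr rfl fun T _ => ?_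
      rw [numColorings_succ, Finset.mul_sum]
      refine Finset.sum_congr rfl fun A _ => ?_
      rw [hF, sdiff_sdiff_left]
      simp only [Finset.sup_eq_union]
      ring
    have e3 : ∑ B ∈ S.powerset, indep G B * ((S \ B).card * numColorings G (S \ B) k) =
        k * ∑ T ∈ S.powerset, -(-1 : ℝ) ^ T.card * numRooted G T *
          numColorings G (S \ T) (k + 1) := by
      have e4 : ∀ B ∈ S.powerset, indep G B * ((S \ B).card * numColorings G (S \ B) k) =
          ∑ T ∈ (S \ B).powerset, indep G B * (k * (-(-1 : ℝ) ^ T.card * numRooted G T *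
            numColorings G ((S \ B) \ T) k)) := by
        intro B _
        rw [ih, Finset.mul_sum, Finset.mul_sum]
      rw [Finset.sum_congr rfl e4, sum_powerset_sdiff_comm, Finset.mul_sum]
      refine Finset.sum_congr rfl fun T _ => ?_
      rw [numColorings_succ, Finset.mul_sum, Finset.mul_sum]
      refine Finset.sum_congr rfl fun A _ => ?_
      rw [sdiff_right_comm]
      ring
    have e5 : (S.card : ℝ) * numColorings G S (k + 1) =
        ∑ B ∈ S.powerset, B.card * indep G B * numColorings G (S \ B) k +
        ∑ B ∈ S.powerset, indep G B * ((S \ B).card * numColorings G (S \ B) k) := by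
      rw [numColorings_succ, Finset.mul_sum, ← Finset.sum_add_distrib]
      refine Finset.sum_congr rfl fun B hB => ?_
      rw [← Finset.card_sdiff_add_card_eq_card (Finset.mem_powerset.1 hB)]
      push_cast
      ring
    rw [e5, e1, e3]
    push_cast
    ring

end Colorings

/-! ### The recursion for chromatic polynomials -/

section Polynomials

variable {V : Type*} (G : SimpleGraph V)

/-- The chromatic polynomial of the subgraph induced by `S`. -/
noncomputable def inducedPoly (S : Finset V) : ℝ[X] := chromaticPoly (G.induce (S : Set V))

theorem inducedPoly_empty : inducedPoly G ∅ = 1 := by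
  refine (chromaticPoly_unique _ 1 fun k _ => ?_).symm
  rw [eval_one, ← Nat.cast_one, ← numColorings_empty G k, numColorings]

variable [Fintype V]

theorem inducedPoly_univ : inducedPoly G Finset.univ = chromaticPoly G := by
  refine chromaticPoly_unique G _ fun k hk => ?_
  rw [inducedPoly, chromaticPoly_eval _ k hk]
  have h : ∀ s : Set V, s = Set.univ →
      Nat.card ((G.induce s).Coloring (Fin k)) = Nat.card (G.Coloring (Fin k)) := by
    rintro _ rfl
    exact Nat.card_congr (SimpleGraph.coloringCongr G.induceUnivIso (Equiv.refl _))
  rw [h _ Finset.coe_univ]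

variable [DecidableEq V]

theorem card_mul_inducedPoly (S : Finset V) :
    C (S.card : ℝ) * inducedPoly G S = X * ∑ T ∈ S.powerset,
      C (-(-1 : ℝ) ^ T.card * numRooted G T) * inducedPoly G (S \ T) := by
  refine Polynomial.eq_of_infinite_eval_eq _ _
    (Set.infinite_of_injective_forall_mem (f := fun k : ℕ => ((k + 1 : ℕ) : ℝ)) ?_ ?_)
  · intro a b h
    simpa using h
  · intro k
    have h : ∀ T, (inducedPoly G T).eval ((k + 1 : ℕ) : ℝ) = numColorings G T (k + 1) :=
      fun T => chromaticPoly_eval _ _ k.succ_pos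
    simp only [Set.mem_ofPred_eq, eval_mul, eval_C, eval_X, eval_finsetSum, h]
    exact card_mul_numColorings G S (k + 1)

/-- Only nonempty T contribute to the recursion, and its factor `X` adds one to the degree. -/
theorem natDegree_inducedPoly_le (S : Finset V) : (inducedPoly G S).natDegree ≤ S.card := by
  induction S using Finset.strongInduction with
  | _ S ih =>
  rcases S.eq_empty_or_nonempty with rfl | hS
  · simp [inducedPoly_empty]
  have hn : (S.card : ℝ) ≠ 0 := by exact_mod_cast hS.card_pos.ne'
  rw [← natDegree_C_mul hn, card_mul_inducedPoly]
  have hpos := hS.card_pos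
  have h : (∑ T ∈ S.powerset, C (-(-1 : ℝ) ^ T.card * numRooted G T) *
      inducedPoly G (S \ T)).natDegree ≤ S.card - 1 := by
    refine natDegree_sum_le_of_forall_le _ _ fun T hT => ?_
    rcases T.eq_empty_or_nonempty with rfl | hT'
    · simp [numRooted_empty]
    · have hss := Finset.sdiff_ssubset (Finset.mem_powerset.1 hT) hT'
      have := Finset.card_lt_card hss
      exact (natDegree_C_mul_le _ _).trans ((ih _ hss).trans (by omega))
  refine natDegree_mul_le.trans ?_
  rw [natDegree_X]
  omega

theorem coeff_zero_inducedPoly {S : Finset V} (hS : S.Nonempty) :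
    (inducedPoly G S).coeff 0 = 0 := by
  have h := congrArg (fun p : ℝ[X] => p.coeff 0) (card_mul_inducedPoly G S)
  simp only [mul_coeff_zero, coeff_C_zero, coeff_X_zero, zero_mul] at h
  exact (mul_eq_zero.1 h).resolve_left (by exact_mod_cast hS.card_pos.ne')

/-- Evaluating at -y and scaling by (-1)^|S| absorbs the signs of the recursion. -/
theorem isSetExp_inducedPoly (y : ℝ) :
    IsSetExp (fun T => (numRooted G T : ℝ)) y
      (fun S => (-1) ^ S.card * (inducedPoly G S).eval (-y))
      (fun S => -((-1) ^ S.card * (derivative (inducedPoly G S)).eval (-y))) where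
  empty := by simp [inducedPoly_empty]
  deriv_empty := by simp [inducedPoly_empty]
  card_mul S := by
    have h := congrArg (fun p : ℝ[X] => p.eval (-y)) (card_mul_inducedPoly G S)
    simp only [eval_mul, eval_C, eval_X, eval_finsetSum] at h
    rw [mul_left_comm, h, Finset.mul_sum, Finset.mul_sum, Finset.mul_sum]
    refine Finset.sum_congr rfl fun T hT => ?_
    rw [← Finset.card_sdiff_add_card_eq_card (Finset.mem_powerset.1 hT), pow_add]
    have h1 : ((-1 : ℝ) ^ T.card) * (-1) ^ T.card = 1 := by rw [← mul_pow]; simp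
    linear_combination ((-1 : ℝ) ^ (S \ T).card * y * numRooted G T *
      (inducedPoly G (S \ T)).eval (-y)) * h1
  card_mul_deriv S := by
    have h := congrArg (fun p : ℝ[X] => (derivative p).eval (-y)) (card_mul_inducedPoly G S)
    simp only [derivative_mul, derivative_C, derivative_X, derivative_sum, eval_add, eval_mul,
      eval_C, eval_X, eval_finsetSum, zero_mul, zero_add, one_mul] at h
    rw [mul_neg, mul_left_comm, h, mul_add, neg_add, Finset.mul_sum, Finset.mul_sum,
      Finset.mul_sum, Finset.mul_sum, ← Finset.sum_neg_distrib, ← Finset.sum_neg_distrib]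
    congr 1 <;> refine Finset.sum_congr rfl fun T hT => ?_ <;>
      rw [← Finset.card_sdiff_add_card_eq_card (Finset.mem_powerset.1 hT), pow_add] <;>
      have h1 : ((-1 : ℝ) ^ T.card) * (-1) ^ T.card = 1 := by rw [← mul_pow]; simp
    · linear_combination ((-1 : ℝ) ^ (S \ T).card * numRooted G T *
        (inducedPoly G (S \ T)).eval (-y)) * h1
    · linear_combination -((-1 : ℝ) ^ (S \ T).card * y * numRooted G T *
        (derivative (inducedPoly G (S \ T))).eval (-y)) * h1

theorem mul_numRooted_le_real (T : Finset V) (j : ℕ) (hj : j + 1 ≤ T.card) :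
    (j : ℝ) * numRooted G T ≤ ∑ k ∈ Finset.range j, ∑ R ∈ T.powersetCard (k + 1),
      (numRooted G R : ℝ) * numRooted G (T \ R) := by
  exact_mod_cast mul_numRooted_le G T j hj

end Polynomials

/-! ### Comparison with the complete graph -/

section Main

variable {V : Type*} [Finite V] (G : SimpleGraph V)

theorem chromaticPoly_eval_neg_pos {y : ℝ} (hy : 0 < y) :
    0 < (-1) ^ Nat.card V * (chromaticPoly G).eval (-y) := by
  classical
  have := Fintype.ofFinite V
  have h := (isSetExp_inducedPoly G y).pos hy (by simp [numRooted_empty])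
    (by simp [numRooted_singleton]) (fun _ => Nat.cast_nonneg _) Finset.univ
  rwa [inducedPoly_univ, Finset.card_univ, ← Nat.card_eq_fintype_card] at h

theorem chromaticPoly_eval_ne_zero {x : ℝ} (hx : x < 0) : (chromaticPoly G).eval x ≠ 0 := by
  have h := chromaticPoly_eval_neg_pos G (neg_pos.2 hx)
  rw [neg_neg] at h
  exact right_ne_zero_of_mul h.ne'

theorem natDegree_chromaticPoly_le : (chromaticPoly G).natDegree ≤ Nat.card V := by
  classical
  have := Fintype.ofFinite V
  rw [← inducedPoly_univ, Nat.card_eq_fintype_card, ← Finset.card_univ]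
  exact natDegree_inducedPoly_le G _

theorem coeff_zero_chromaticPoly [Nonempty V] : (chromaticPoly G).coeff 0 = 0 := by
  classical
  have := Fintype.ofFinite V
  rw [← inducedPoly_univ]
  exact coeff_zero_inducedPoly G Finset.univ_nonempty

variable {G} in
theorem chromaticEps_lt_of_ne_top (hG : G ≠ ⊤) {x : ℝ} (hx : x < 0) :
    chromaticEps G x < -harmonicShift (-x) (Nat.card V) := by
  classical
  have := Fintype.ofFinite V
  obtain ⟨u, v, huv, hadj⟩ := SimpleGraph.ne_top_iff_exists_not_adj.1 hG
  have hy : 0 < -x := neg_pos.2 hx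
  have h := ((isSetExp_inducedPoly G (-x)).harmonicShift_mul_le hy (by simp [numRooted_empty])
    (by simp [numRooted_singleton]) (fun _ => Nat.cast_nonneg _)
    (mul_numRooted_le_real G) Finset.univ).2
    ⟨{u, v}, Finset.subset_univ _, Finset.card_pair huv, by simp [numRooted_pair G huv hadj]⟩
  have hpos := chromaticPoly_eval_neg_pos G hy
  rw [inducedPoly_univ, Finset.card_univ, ← Nat.card_eq_fintype_card] at h
  rw [neg_neg] at h hpos
  have hs : ((-1 : ℝ) ^ Nat.card V) ≠ 0 := pow_ne_zero _ (by norm_num)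
  rw [chromaticEps, ← mul_div_mul_left _ _ hs, div_lt_iff₀ hpos]
  linarith

theorem chromaticPoly_top (n : ℕ) :
    chromaticPoly (⊤ : SimpleGraph (Fin n)) = descPochhammer ℝ n := by
  refine (chromaticPoly_unique _ _ fun k _ => ?_).symm
  rw [descPochhammer_eval_eq_descFactorial]
  have e : (⊤ : SimpleGraph (Fin n)).Coloring (Fin k) ≃ (Fin n ↪ Fin k) :=
    { toFun := fun C => ⟨C, fun a b h => by
        by_contra hab
        exact C.valid (by simpa using hab) h⟩
      invFun := fun f => SimpleGraph.Coloring.mk f fun {a b} hab h => hab.ne (f.injective h)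
      left_inv := fun C => rfl
      right_inv := fun f => rfl }
  rw [Nat.card_congr e, Nat.card_eq_fintype_card, Fintype.card_embedding_eq]
  simp

theorem chromaticEps_top (n : ℕ) {x : ℝ} (hx : x < 0) :
    chromaticEps (⊤ : SimpleGraph (Fin n)) x = -harmonicShift (-x) n := by
  rw [chromaticEps, div_eq_iff (chromaticPoly_eval_ne_zero _ hx), chromaticPoly_top]
  induction n with
  | zero => simp [harmonicShift]
  | succ n ih =>
    have hxn : -x + n ≠ 0 := by
      have : (0 : ℝ) ≤ n := Nat.cast_nonneg n
      linarith
    rw [harmonicShift, Finset.sum_range_succ, ← harmonicShift, descPochhammer_succ_right]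
    simp only [derivative_mul, derivative_sub, derivative_X, derivative_natCast, sub_zero, mul_one,
      eval_add, eval_mul, eval_sub, eval_X, eval_natCast, ih]
    field_simp
    ring

/-- At x = -1 the terms a_i all get the same sign (-1)^n, and weighting by i amounts to applying x
d/dx. -/
theorem meanSize_eq [Nonempty V] :
    meanSize G = Nat.card V + chromaticEps G (-1) := by
  set n := Nat.card V with hn
  set p := chromaticPoly G with hp
  have hsq : ∀ i : ℕ, ((-1 : ℝ) ^ i) * (-1) ^ i = 1 := fun i => by rw [← mul_pow]; simp
  have hcoef : ∀ i ∈ Finset.Icc 1 n, chromaticCoeff G i = (-1) ^ n * (p.coeff i * (-1) ^ i) := by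
    intro i hi
    obtain ⟨k, hk⟩ := Nat.exists_eq_add_of_le (Finset.mem_Icc.1 hi).2
    rw [chromaticCoeff, ← hn, ← hp, hk, Nat.add_sub_cancel_left, pow_add]
    linear_combination -((-1) ^ k * p.coeff i) * hsq i
  have hrange : ∀ f : ℕ → ℝ, f 0 = 0 →
      ∑ i ∈ Finset.range (n + 1), f i = ∑ i ∈ Finset.Icc 1 n, f i := by
    intro f hf
    rw [Finset.sum_range_succ', hf, add_zero, Finset.range_eq_Ico,
      Finset.sum_Ico_add' f 0 n 1]
    rfl
  have hdeg : p.natDegree < n + 1 := Nat.lt_succ_of_le (natDegree_chromaticPoly_le G)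
  -- The sum may start at 1 because the constant coefficient vanishes for a nonempty vertex set.
  have h1 : ∑ i ∈ Finset.Icc 1 n, chromaticCoeff G i = (-1) ^ n * p.eval (-1) := by
    rw [Finset.sum_congr rfl hcoef, ← Finset.mul_sum, eval_eq_sum_range' hdeg,
      hrange _ (by rw [hp, coeff_zero_chromaticPoly, zero_mul])]
  have h2 : ∑ i ∈ Finset.Icc 1 n, ((n : ℝ) - i) * chromaticCoeff G i =
      (-1) ^ n * (n * p.eval (-1) + (derivative p).eval (-1)) := by
    have h3 : (derivative p).eval (-1) = -∑ i ∈ Finset.Icc 1 n, i * (p.coeff i * (-1) ^ i) := by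
      rw [← hrange _ (by simp), derivative_eval, sum_over_range' _ _ (n + 1) hdeg,
        ← Finset.sum_neg_distrib]
      · refine Finset.sum_congr rfl fun i _ => ?_
        cases i with
        | zero => simp
        | succ i =>
          rw [Nat.add_sub_cancel, pow_succ]
          ring
      · simp
    have h4 : ∑ i ∈ Finset.Icc 1 n, ((n : ℝ) - i) * chromaticCoeff G i =
        n * ∑ i ∈ Finset.Icc 1 n, chromaticCoeff G i -
          (-1) ^ n * ∑ i ∈ Finset.Icc 1 n, i * (p.coeff i * (-1) ^ i) := by
      rw [Finset.mul_sum, Finset.mul_sum, ← Finset.sum_sub_distrib]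
      refine Finset.sum_congr rfl fun i hi => ?_
      rw [hcoef i hi]
      ring
    rw [h4, h1, h3]
    ring
  have hne : p.eval (-1) ≠ 0 := chromaticPoly_eval_ne_zero G (by norm_num)
  rw [meanSize, ← hn, h1, h2, mul_div_mul_left _ _ (pow_ne_zero _ (by norm_num)), chromaticEps,
    add_div, mul_div_cancel_right₀ _ hne]

end Main

end ChromaticPoly

theorem mainTheorem1 {V : Type*} [Finite V] (G : SimpleGraph V) (n : ℕ) (hn : Nat.card V = n)
    (hG : G ≠ ⊤) :
    (∀ x : ℝ, x < 0 → chromaticEps G x < chromaticEps (⊤ : SimpleGraph (Fin n)) x) ∧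
      meanSize G < meanSize (⊤ : SimpleGraph (Fin n)) := by
  have h : ∀ x : ℝ, x < 0 → chromaticEps G x < chromaticEps (⊤ : SimpleGraph (Fin n)) x := by
    intro x hx
    rw [ChromaticPoly.chromaticEps_top n hx, ← hn]
    exact ChromaticPoly.chromaticEps_lt_of_ne_top hG hx
  refine ⟨h, ?_⟩
  obtain ⟨u, -⟩ := SimpleGraph.ne_top_iff_exists_not_adj.1 hG
  have : Nonempty V := ⟨u⟩
  have : Nonempty (Fin n) := ⟨⟨0, hn ▸ Nat.card_pos⟩⟩
  rw [ChromaticPoly.meanSize_eq, ChromaticPoly.meanSize_eq, hn, Nat.card_fin]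
  linarith [h (-1) (by norm_num)]
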